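/- Let $B$ be a real Banach space with dual $B^*$ and pairing $(f,\mu)$, and let $D\subset B$ be a dense linear subspace which is itself a Banach space with a norm $\|\cdot\|_D\ge\|\cdot\|_B$; thus $B^*\subset D^*$. Let $T>0$, and let $\mathcal M\subset B^*$ be a convex set with $\sup_{\nu\in\mathcal M}\|\nu\|_{B^*}\le K<\infty$ which is closed in the norm topologies of both $B^*$ and $D^*$. Fix $\mu\in\mathcal M$ and let $C_\mu([0,T],\mathcal M(D^*))$ be the set of $D^*$-norm continuous curves $\xi_\cdot:[0,T]\to\mathcal M$ with $\xi_0=\mu$. Let $c_1,c_2,c_3>0$ and suppose the following. (i) For $t\in[0,T]$ and $\xi_\cdot\in C_\mu([0,T],\mathcal M(D^*))$, $A[t,\{\xi_\cdot\}]:D\to B$ is a bounded linear operator, and for all $\xi_\cdot,\eta_\cdot\in C_\mu([0,T],\mathcal M(D^*))$ $$\sup_{t\in[0,T]}\|A[t,\{\xi_\cdot\}]-A[t,\{\eta_\cdot\}]\|_{D\to B}\le c_1\sup_{t\in[0,T]}\|\xi_t-\eta_t\|_{D^*},\qquad \sup_{t\in[0,T]}\|A[t,\{\xi_\cdot\}]\|_{D\to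 B}\le c_1 .$$ (ii) For every $\xi_\cdot\in C_\mu([0,T],\mathcal M(D^*))$ there is a family $U^{t,s}=U^{t,s}[\{\xi_\cdot\}]$, $0\le t\le s\le T$, of bounded linear operators in $B$, strongly continuous in $(t,s)$, with $U^{t,t}=\mathrm{Id}$ and $U^{t,s}U^{s,r}=U^{t,r}$ for $t\le s\le r$ (a strongly continuous backward propagator), which leaves $D$ invariant, satisfies $\|U^{t,s}\|_{D\to D}\le c_2$ and $\|U^{t,s}\|_{B\to B}\le c_3$, and is generated by $A_t=A[t,\{\xi_\cdot\}]$ on $D$. The last means that there is a Lebesgue null set $S=S[\{\xi_\cdot\}]$ such that for every $f\in D$ the map $t\mapsto A_tf$ is continuous on $[0,T]\setminus S$ and $$\frac{d}{ds}U^{t,s}f=U^{t,s}A_sf,\qquad \frac{d}{ds}U^{s,r}f=-A_sU^{s,r}f,\qquad 0\le t\le s\le r\le T,$$ in the norm of $B$ for all $s\notin S$ (one-sided derivatives at the end points), where $s\mapsto U^{t,s}f$ and $s\mapsto U^{s,r}f$ are absolutely continuous (which is automatic if $S=\emptyset$). Moreover the dual operators $\tilde U^{s,t}[\{\xi_\cdot\}]=(U^{t,s}[\{\xi_\cdot\}])^*$,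 $t\le s$, map $\mathcal M$ into itself. (iii) For every $t$ in some dense subset of $[0,T]$, the set $\{\tilde U^{t,0}[\{\xi_\cdot\}]\mu:\ \xi_\cdot\in C_\mu([0,T],\mathcal M(D^*))\}$ is relatively compact in $\mathcal M$ with the norm topology of $D^*$. Then (without any smallness condition on $c_1c_2c_3KT$) the Cauchy problem $$\frac{d}{dt}(f,\mu_t)=(A[t,\{\mu_s\}_{0\le s\le T}]f,\mu_t)\quad\text{for all } f\in D,\qquad \mu_0=\mu,\qquad t\in[0,T],$$ has a solution $\mu_\cdot\in C_\mu([0,T],\mathcal M(D^*))$: for every $f\in D$ the function $t\mapsto(f,\mu_t)$ is absolutely continuous on $[0,T]$ and satisfies the equation at every $t\in[0,T]\setminus S[\{\mu_\cdot\}]$ (one-sided derivatives at the end points); in particular at every $t\in[0,T]$ if $S[\{\mu_\cdot\}]=\emptyset$. -/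

import Mathlib

open Set MeasureTheory

namespace PathKinetic

variable {B D : Type*} [NormedAddCommGroup B] [NormedSpace ℝ B]
  [NormedAddCommGroup D] [NormedSpace ℝ D]

/-- The restriction to `D` of a functional on `B`, i.e. the image of `μ ∈ B*` in `D*`, where `ι` is
the inclusion of `D` into `B`. If `D` is dense in `B`, this map is injective and identifies `B*` with
a subspace of `D*`. -/
def toDualD (ι : D →L[ℝ] B) (μ : StrongDual ℝ B) : StrongDual ℝ D := μ.comp ι

/-- `C_μ([0,T], M(D*))`: the curves `[0,T] → D*`, continuous in the norm of `D*`, with values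
in `M ⊆ B*` and with initial value `μ`. It carries the sup-norm distance of `C([0,T], D*)`. -/
def PathSpace (ι : D →L[ℝ] B) (M : Set (StrongDual ℝ B)) (T : ℝ) (μ : StrongDual ℝ B) :
    Set C(Icc (0 : ℝ) T, StrongDual ℝ D) :=
  {ξ | (∀ t, ξ t ∈ toDualD ι '' M) ∧ ∀ h : (0 : ℝ) ∈ Icc (0 : ℝ) T, ξ ⟨0, h⟩ = toDualD ι μ}

/-- `U t s` for `0 ≤ t ≤ s ≤ T` is a strongly continuous backward propagator of bounded linear
operators in `B`. -/
structure IsBackwardPropagator (T : ℝ) (U : ℝ → ℝ → B →L[ℝ] B) : Prop where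
  refl : ∀ t ∈ Icc 0 T, U t t = ContinuousLinearMap.id ℝ B
  chain : ∀ t s r, 0 ≤ t → t ≤ s → s ≤ r → r ≤ T → (U t s).comp (U s r) = U t r
  strongly_continuous : ∀ f : B,
    ContinuousOn (fun p : ℝ × ℝ => U p.1 p.2 f) {p | 0 ≤ p.1 ∧ p.1 ≤ p.2 ∧ p.2 ≤ T}

/-- The family `A t : D → B`, `t ∈ [0,T]`, generates the backward propagator `U` on the common
invariant domain `D`, with the exceptional null set `S`:
`d/ds U^{t,s} f = U^{t,s} A_s f` and `d/ds U^{s,r} f = - A_s U^{s,r} f` for `s ∉ S`, `t ≤ s ≤ r`,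
with derivatives in the norm of `B` (one-sided at the end points).
As for any differential equation which is required only outside a null set, the differentiated
functions are absolutely continuous; for bounded families and countable `S`, in particular for
`S = ∅`, this follows from the other conditions. -/
structure Generates (ι : D →L[ℝ] B) (T : ℝ) (A : ℝ → D →L[ℝ] B) (U : ℝ → ℝ → B →L[ℝ] B)
    (S : Set ℝ) : Prop where
  null : volume S = 0
  strongly_continuous : ∀ f : D, ContinuousOn (fun t => A t f) (Icc 0 T \ S)
  invariant : ∀ t s, 0 ≤ t → t ≤ s → s ≤ T → ∀ f : D, ∃ g : D, ι g = U t s (ι f)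
  absCont_right : ∀ t ∈ Icc 0 T, ∀ f : D,
    AbsolutelyContinuousOnInterval (fun s => U t s (ι f)) t T
  absCont_left : ∀ r ∈ Icc 0 T, ∀ f : D,
    AbsolutelyContinuousOnInterval (fun s => U s r (ι f)) 0 r
  deriv_right : ∀ t ∈ Icc 0 T, ∀ f : D, ∀ s ∈ Icc t T \ S,
    HasDerivWithinAt (fun σ => U t σ (ι f)) (U t s (A s f)) (Icc t T) s
  deriv_left : ∀ r ∈ Icc 0 T, ∀ f : D, ∀ s ∈ Icc 0 r \ S, ∀ g : D, ι g = U s r (ι f) →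
    HasDerivWithinAt (fun σ => U σ r (ι f)) (-(A s g)) (Icc 0 r) s

/-- The dual propagator `Ũ^{s,t} : B* → B*`, `t ≤ s`, with `(f, Ũ^{s,t} μ) = (U^{t,s} f, μ)`. -/
def dualPropagator (U : ℝ → ℝ → B →L[ℝ] B) (s t : ℝ) (μ : StrongDual ℝ B) : StrongDual ℝ B :=
  μ.comp (U t s)

/-- The curve `ν : [0,T] → M ⊆ B*`, whose image in `D*` is the path `ξ ∈ C_μ([0,T], M(D*))`, solves
`d/dt (f, ν_t) = (A[t, ν.] f, ν_t)`, `ν_0 = μ`, for all `f ∈ D`. The equation holds at all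
`t ∈ [0,T]` outside `S` (with one-sided derivatives at the end points), and `t ↦ (f, ν_t)` is
absolutely continuous. For `S = ∅` this is the equation at every `t ∈ [0,T]`. -/
structure IsSolution (ι : D →L[ℝ] B) (M : Set (StrongDual ℝ B)) (T : ℝ) (μ : StrongDual ℝ B)
    (A : ℝ → PathSpace ι M T μ → D →L[ℝ] B) (S : Set ℝ)
    (ξ : PathSpace ι M T μ) (ν : ℝ → StrongDual ℝ B) : Prop where
  mem : ∀ t ∈ Icc 0 T, ν t ∈ M
  path : ∀ t : Icc (0 : ℝ) T, toDualD ι (ν t) = ξ.1 t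
  init : ν 0 = μ
  absCont : ∀ f : D, AbsolutelyContinuousOnInterval (fun t => ν t (ι f)) 0 T
  equation : ∀ f : D, ∀ t ∈ Icc 0 T \ S,
    HasDerivWithinAt (fun τ => ν τ (ι f)) (ν t (A t ξ f)) (Icc 0 T) t

end PathKinetic

/-! A solution is a fixed point of `Φ`, which sends a path `ξ` to `t ↦ Ũ^{t,0}[ξ] μ`: at a fixed
point, pairing `d/dt U^{0,t} f = U^{0,t} A_t f` with `μ` gives the equation. The contraction
principle would need a small Lipschitz constant for `Φ`; Schauder's theorem needs only continuity
and a relatively compact image.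

Continuity is Duhamel's comparison of two propagators (`Generates.norm_sub_le`), which makes `Φ`
Lipschitz in the `D*` norm. All image paths share one Lipschitz constant in `D*`
(`Generates.norm_right_sub_le`), so compactness at a dense set of times suffices for Arzelà–Ascoli
(`isCompact_closure_of_lipschitzWith_of_dense`). The path space is convex and closed because `M` is
convex and closed in `D*`.

Schauder is reduced to Brouwer by a finite net, and Brouwer is proved analytically. For `g`
Lipschitz and zero outside a ball, `∫ det(1 + t Dg)` over the ball is polynomial in `t` and equals
the volume for small `t`, hence also at `t = 1`. A Lipschitz retraction onto the sphere would have
zero Jacobian almost everywhere, a contradiction. -/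

/-! ### Jacobian integrals of Lipschitz perturbations of the identity. -/

section LipschitzPerturbation

open Module Metric Filter Topology

variable {E : Type*} [NormedAddCommGroup E] [NormedSpace ℝ E] [FiniteDimensional ℝ E]

/-- Needed to discard the image of Rademacher's exceptional set. Haar measure has the same null sets
as Hausdorff measure of dimension `finrank ℝ E`, which a Lipschitz map enlarges by a bounded factor.
-/
theorem LipschitzWith.addHaar_image_eq_zero [MeasurableSpace E] [BorelSpace E] (μ : Measure E)
    [μ.IsAddHaarMeasure] {K : NNReal} {f : E → E} (hf : LipschitzWith K f) {s : Set E}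
    (hs : μ s = 0) : μ (f '' s) = 0 := by
  have h0 : (Measure.hausdorffMeasure (finrank ℝ E) : Measure E) s = 0 :=
    Measure.absolutelyContinuous_isAddHaarMeasure _ μ hs
  refine Measure.absolutelyContinuous_isAddHaarMeasure μ
    (Measure.hausdorffMeasure (finrank ℝ E)) (le_antisymm ?_ zero_le)
  simpa [h0] using hf.hausdorffMeasure_image_le (d := finrank ℝ E) (by positivity) s

/-- The determinant is 1 at `t = 0` and cannot vanish along `1 + t • A`, since a kernel vector would
satisfy `‖v‖ ≤ ‖A‖ ‖v‖`. -/
theorem ContinuousLinearMap.det_one_add_pos {A : E →L[ℝ] E} (hA : ‖A‖ < 1) : 0 < (1 + A).det := by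
  have hne : ∀ t ∈ Icc (0 : ℝ) 1, (1 + t • A).det ≠ 0 := by
    intro t ht h0
    have hker : ((1 + t • A : E →L[ℝ] E) : E →ₗ[ℝ] E).ker ≠ ⊥ := by
      intro hk
      exact (LinearMap.isUnit_iff_isUnit_det _).1 ((LinearMap.isUnit_iff_ker_eq_bot _).2 hk)
        |>.ne_zero h0
    obtain ⟨v, hv, hv0⟩ := Submodule.exists_mem_ne_zero_of_ne_bot hker
    have h1 : v = -(t • A v) := by
      have : v + t • A v = 0 := by simpa using hv
      exact eq_neg_of_add_eq_zero_left this
    have h2 : ‖v‖ ≤ ‖A‖ * ‖v‖ := by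
      calc ‖v‖ = |t| * ‖A v‖ := by
            conv_lhs => rw [h1, norm_neg, norm_smul, Real.norm_eq_abs]
        _ ≤ 1 * ‖A v‖ := by
          gcongr
          rw [abs_of_nonneg ht.1]
          exact ht.2
        _ ≤ ‖A‖ * ‖v‖ := by simpa using A.le_opNorm v
    nlinarith [norm_pos_iff.2 hv0]
  by_contra hneg
  have hcont : ContinuousOn (fun t : ℝ => (1 + t • A).det) (Icc 0 1) := by
    refine (ContinuousLinearMap.continuous_det.comp ?_).continuousOn
    fun_prop
  obtain ⟨t, ht, h0⟩ := intermediate_value_Icc' zero_le_one hcont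
    (show (0 : ℝ) ∈ Icc _ _ by
      refine ⟨by simpa using hneg, ?_⟩
      simp [ContinuousLinearMap.det])
  exact hne t ht h0

theorem ContinuousLinearMap.exists_polynomial_det_one_add_smul (A : E →L[ℝ] E) :
    ∃ q : Polynomial ℝ, q.natDegree ≤ finrank ℝ E ∧ ∀ t : ℝ, q.eval t = (1 + t • A).det := by
  classical
  let b := finBasis ℝ E
  let N := LinearMap.toMatrix b b (A : E →ₗ[ℝ] E)
  refine ⟨((Polynomial.X : Polynomial ℝ) • N.map Polynomial.C +
    (1 : Matrix _ _ ℝ).map Polynomial.C).det, ?_, fun t => ?_⟩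
  · simpa using Polynomial.natDegree_det_X_add_C_le N 1
  · rw [← Polynomial.coe_evalRingHom, RingHom.map_det, ContinuousLinearMap.det,
      ← LinearMap.det_toMatrix b]
    congr 1
    ext i j
    simp [N, Matrix.one_apply, LinearMap.toMatrix_apply, apply_ite, Finsupp.single_apply, eq_comm]
    split_ifs <;> ring

/-- A perturbation of the identity by a contraction is bijective. It fixes every point outside the
ball, so it must permute the ball. -/
theorem image_ball_id_add_smul {g : E → E} {K : NNReal} (hg : LipschitzWith K g) {R : ℝ}
    (hR : ∀ x, R ≤ ‖x‖ → g x = 0) {t : ℝ} (ht0 : 0 ≤ t) (ht : t * K < 1) :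
    Function.Injective (fun x => x + t • g x) ∧
      (fun x => x + t • g x) '' ball 0 R = ball 0 R := by
  have hlip : ApproximatesLinearOn (fun x => x + t • g x)
      ((ContinuousLinearEquiv.refl ℝ E : E ≃L[ℝ] E) : E →L[ℝ] E) univ (Real.toNNReal t * K) := by
    intro x _ y _
    have : x + t • g x - (y + t • g y) - (x - y) = t • (g x - g y) := by rw [smul_sub]; abel
    simp only [ContinuousLinearEquiv.coe_refl, ContinuousLinearMap.coe_id', id_eq, this, norm_smul,
      Real.norm_of_nonneg ht0, NNReal.coe_mul, Real.coe_toNNReal t ht0, mul_assoc]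
    exact mul_le_mul_of_nonneg_left (hg.norm_sub_le x y) ht0
  have hc : Subsingleton E ∨ Real.toNNReal t * K < ‖((ContinuousLinearEquiv.refl ℝ E).symm :
      E →L[ℝ] E)‖₊⁻¹ := by
    rcases subsingleton_or_nontrivial E with h | h
    · exact Or.inl h
    · right
      have : ‖((ContinuousLinearEquiv.refl ℝ E).symm : E →L[ℝ] E)‖₊ = 1 := by
        ext; simp
      rw [this, inv_one, ← NNReal.coe_lt_coe]
      simpa [Real.coe_toNNReal t ht0] using ht
  have hinj : Function.Injective (fun x => x + t • g x) := injOn_univ.1 (hlip.injOn hc)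
  have hsurj := hlip.surjective hc
  have hout : ∀ x, R ≤ ‖x‖ → x + t • g x = x := fun x hx => by simp [hR x hx]
  refine ⟨hinj, Subset.antisymm ?_ ?_⟩
  · rintro _ ⟨x, hx, rfl⟩
    by_contra hn
    have h1 : R ≤ ‖x + t • g x‖ := by simpa using hn
    have h2 := hinj (hout _ h1)
    rw [mem_ball_zero_iff, ← h2] at hx
    exact absurd hx (not_lt.2 h1)
  · intro y hy
    obtain ⟨x, rfl⟩ := hsurj y
    refine ⟨x, ?_, rfl⟩
    by_contra hn
    have h1 : R ≤ ‖x‖ := by simpa using hn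
    simp only [hout x h1] at hy
    exact hn hy

variable [MeasurableSpace E] [BorelSpace E] (μ : Measure E) [μ.IsAddHaarMeasure]

/-- The area formula on the set of differentiability; positivity of the determinant removes the
absolute value. -/
theorem integral_det_one_add_smul_fderiv_of_small {g : E → E} {K : NNReal} (hg : LipschitzWith K g)
    {R : ℝ} (hR : ∀ x, R ≤ ‖x‖ → g x = 0) {t : ℝ} (ht0 : 0 ≤ t) (ht : t * K < 1) :
    IntegrableOn (fun x => (1 + t • fderiv ℝ g x).det) (ball 0 R) μ ∧
      ∫ x in ball 0 R, (1 + t • fderiv ℝ g x).det ∂μ = μ.real (ball 0 R) := by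
  obtain ⟨hinj, himg⟩ := image_ball_id_add_smul hg hR ht0 ht
  set s : Set E := ball 0 R ∩ {x | DifferentiableAt ℝ g x}
  have hs : MeasurableSet s := measurableSet_ball.inter (measurableSet_of_differentiableAt ℝ g)
  have hnull : μ (ball 0 R \ s) = 0 :=
    measure_mono_null (fun x hx hd => hx.2 ⟨hx.1, hd⟩) hg.ae_differentiableAt
  have hsub : s ⊆ ball 0 R := inter_subset_left
  have hae : s =ᵐ[μ] ball 0 R := hsub.eventuallyLE.antisymm (ae_le_set.2 hnull)
  have hder : ∀ x ∈ s, HasFDerivWithinAt (fun x => x + t • g x) (1 + t • fderiv ℝ g x) s x :=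
    fun x hx => ((hasFDerivAt_id x).add (hx.2.hasFDerivAt.const_smul t)).hasFDerivWithinAt
  have hlint := lintegral_abs_det_fderiv_eq_addHaar_image μ hs hder hinj.injOn
  have hpos : ∀ x, 0 < (1 + t • fderiv ℝ g x).det := fun x => by
    refine ContinuousLinearMap.det_one_add_pos (lt_of_le_of_lt ?_ ht)
    rw [norm_smul, Real.norm_of_nonneg ht0]
    exact mul_le_mul_of_nonneg_left (norm_fderiv_le_of_lipschitz ℝ hg) ht0
  have hmeas : μ ((fun x => x + t • g x) '' s) = μ (ball 0 R) := by
    refine le_antisymm ((measure_mono (image_mono hsub)).trans_eq (by rw [himg])) ?_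
    have hcl : LipschitzWith (1 + Real.toNNReal t * K) (fun x => x + t • g x) :=
      LipschitzWith.id.add (((lipschitzWith_smul t).comp hg).weaken (by
        gcongr
        rw [← NNReal.coe_le_coe]
        simp [ht0, abs_of_nonneg ht0]))
    have hz := hcl.addHaar_image_eq_zero μ hnull
    calc μ (ball 0 R) = μ ((fun x => x + t • g x) '' (s ∪ ball 0 R \ s)) := by
          rw [union_sdiff_cancel hsub, himg]
      _ ≤ _ := by
          rw [image_union]
          refine (measure_union_le _ _).trans ?_
          rw [hz, add_zero]
  have hm : Measurable (fun x => (1 + t • fderiv ℝ g x).det) :=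
    ContinuousLinearMap.continuous_det.measurable.comp
      (((measurable_fderiv ℝ g).const_smul t).const_add 1)
  have hlint' : ∫⁻ x in ball 0 R, ENNReal.ofReal ((1 + t • fderiv ℝ g x).det) ∂μ
      = μ (ball 0 R) := by
    rw [← hmeas, ← hlint, Measure.restrict_congr_set hae]
    simp_rw [abs_of_pos (hpos _)]
  refine ⟨⟨hm.aestronglyMeasurable, ?_⟩, ?_⟩
  · rw [hasFiniteIntegral_iff_ofReal (Eventually.of_forall fun x => (hpos x).le), hlint']
    exact measure_ball_lt_top
  · rw [integral_eq_lintegral_of_nonneg_ae (Eventually.of_forall fun x => (hpos x).le)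
      hm.aestronglyMeasurable, hlint']
    rfl

/-- The integral of the Jacobian determinant of a compactly supported Lipschitz perturbation of the
identity does not depend on the perturbation. -/
theorem integral_det_one_add_fderiv {g : E → E} {K : NNReal} (hg : LipschitzWith K g) {R : ℝ}
    (hR : ∀ x, R ≤ ‖x‖ → g x = 0) :
    ∫ x in ball 0 R, (1 + fderiv ℝ g x).det ∂μ = μ.real (ball 0 R) := by
  set n := finrank ℝ E
  -- `n + 1` distinct nodes, all in the range `v j * K < 1` where the integral is known; they
  -- determine a polynomial of degree at most `n`.
  let v : ℕ → ℝ := fun j => (j : ℝ) / ((n + 1) * (K + 1))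
  have hv : InjOn v (Finset.range (n + 1)) := by
    intro i _ j _ hij
    have hd : ((n : ℝ) + 1) * (K + 1) ≠ 0 := by positivity
    have := (div_left_inj' hd).1 hij
    exact_mod_cast this
  have hv0 : ∀ j, 0 ≤ v j := fun j => by positivity
  have hvK : ∀ j ∈ Finset.range (n + 1), v j * K < 1 := fun j hj => by
    have h1 : (j : ℝ) < n + 1 := by exact_mod_cast Finset.mem_range.1 hj
    have hK : (0 : ℝ) ≤ K := K.2
    rw [div_mul_eq_mul_div, div_lt_one (by positivity)]
    nlinarith
  have key : ∀ q : Polynomial ℝ, q.natDegree ≤ n → q.eval 1 =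
      ∑ j ∈ Finset.range (n + 1), q.eval (v j) *
        (Lagrange.basis (Finset.range (n + 1)) v j).eval 1 := by
    intro q hq
    have h := Lagrange.eq_interpolate (f := q) hv (by
      refine lt_of_le_of_lt Polynomial.degree_le_natDegree ?_
      rw [Finset.card_range]
      exact_mod_cast Nat.lt_succ_of_le hq)
    conv_lhs => rw [h]
    simp [Lagrange.interpolate_apply, Polynomial.eval_finsetSum]
  have hpt : ∀ x, (1 + fderiv ℝ g x).det = ∑ j ∈ Finset.range (n + 1),
      (1 + v j • fderiv ℝ g x).det * (Lagrange.basis (Finset.range (n + 1)) v j).eval 1 := by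
    intro x
    obtain ⟨q, hq, hqe⟩ := (fderiv ℝ g x).exists_polynomial_det_one_add_smul
    have := key q hq
    simpa [hqe] using this
  -- The interpolation weights at 1 do not depend on `x`; the constant polynomial shows that they
  -- sum to 1.
  have hone := key 1 (by simp)
  simp only [Polynomial.eval_one, one_mul] at hone
  simp_rw [hpt]
  have hI := fun j hj => integral_det_one_add_smul_fderiv_of_small μ hg hR (hv0 j) (hvK j hj)
  rw [integral_finsetSum _ fun j hj => (hI j hj).1.mul_const _]
  simp_rw [integral_mul_const]
  rw [Finset.sum_congr rfl fun j hj => by rw [(hI j hj).2], ← Finset.mul_sum, ← hone, mul_one]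

end LipschitzPerturbation

/-! ### Brouwer's fixed point theorem. -/

section Brouwer

open Module Metric Filter Topology

variable {E : Type*} [NormedAddCommGroup E]

/-- A globally Lipschitz substitute for `y / ‖y‖`, equal to it where `ε ≤ ‖y‖`. -/
theorem lipschitzWith_max_norm_inv_smul [NormedSpace ℝ E] {ε : ℝ} (hε : 0 < ε) :
    LipschitzWith (Real.toNNReal (2 / ε)) (fun y : E => (max ε ‖y‖)⁻¹ • y) := by
  refine LipschitzWith.of_dist_le_mul fun x y => ?_
  rw [Real.coe_toNNReal _ (by positivity), dist_eq_norm, dist_eq_norm]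
  set a := max ε ‖x‖ with ha
  set b := max ε ‖y‖ with hb
  have ha0 : 0 < a := lt_max_of_lt_left hε
  have hb0 : 0 < b := lt_max_of_lt_left hε
  have hab : |b - a| ≤ ‖x - y‖ := by
    rw [hb, ha, norm_sub_rev]
    refine (abs_max_sub_max_le_max _ _ _ _).trans ?_
    simpa using abs_norm_sub_norm_le y x
  have hy : b⁻¹ * ‖y‖ ≤ 1 := by
    rw [inv_mul_le_one₀ hb0]
    exact le_max_right _ _
  have haε : a⁻¹ ≤ ε⁻¹ := inv_anti₀ hε (le_max_left _ _)
  have heq : a⁻¹ • x - b⁻¹ • y = a⁻¹ • (x - y) + (a⁻¹ * (b - a) * b⁻¹) • y := by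
    have : a⁻¹ * (b - a) * b⁻¹ = a⁻¹ - b⁻¹ := by field_simp
    rw [this, smul_sub, sub_smul]
    abel
  calc ‖a⁻¹ • x - b⁻¹ • y‖ ≤ a⁻¹ * ‖x - y‖ + a⁻¹ * |b - a| * (b⁻¹ * ‖y‖) := by
        rw [heq]
        refine (norm_add_le _ _).trans (le_of_eq ?_)
        rw [norm_smul, norm_smul, norm_mul, norm_mul, Real.norm_of_nonneg (inv_nonneg.2 ha0.le),
          Real.norm_of_nonneg (inv_nonneg.2 hb0.le), Real.norm_eq_abs]
        ring
    _ ≤ ε⁻¹ * ‖x - y‖ + ε⁻¹ * ‖x - y‖ * 1 := by gcongr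
    _ = 2 / ε * ‖x - y‖ := by ring

theorem LipschitzWith.smul_of_bounded [NormedSpace ℝ E] {X : Type*} [PseudoMetricSpace X]
    {φ : X → ℝ} {f : X → E} {K L : NNReal} (hφ : LipschitzWith K φ) (hf : LipschitzWith L f)
    {a b : NNReal} (hφa : ∀ x, |φ x| ≤ a) (hfb : ∀ x, ‖f x‖ ≤ b) :
    LipschitzWith (a * L + K * b) (fun x => φ x • f x) := by
  refine LipschitzWith.of_dist_le_mul fun x y => ?_
  have heq : φ x • f x - φ y • f y = φ x • (f x - f y) + (φ x - φ y) • f y := by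
    rw [smul_sub, sub_smul]
    abel
  have h1 := hφ.dist_le_mul x y
  have h2 := hf.dist_le_mul x y
  rw [dist_eq_norm] at h1 h2 ⊢
  rw [heq]
  calc _ ≤ ‖φ x‖ * ‖f x - f y‖ + ‖φ x - φ y‖ * ‖f y‖ := by
        rw [← norm_smul, ← norm_smul]
        exact norm_add_le _ _
    _ ≤ a * (L * dist x y) + (K * dist x y) * b := by
        gcongr
        · exact hφa x
        · exact hfb y
    _ = _ := by push_cast; ring

variable [InnerProductSpace ℝ E] [FiniteDimensional ℝ E]

/-- Differentiating `‖r‖²` makes `r x` orthogonal to the range of `A`. -/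
theorem det_eq_zero_of_norm_eventually_const {r : E → E} {A : E →L[ℝ] E} {x : E} {c : ℝ}
    (hr : HasFDerivAt r A x) (hc : ∀ᶠ y in 𝓝 x, ‖r y‖ = c) (hx : r x ≠ 0) : A.det = 0 := by
  by_contra hdet
  have h1 := hr.norm_sq
  have h2 : HasFDerivAt (fun y => ‖r y‖ ^ 2) (0 : E →L[ℝ] ℝ) x :=
    (hasFDerivAt_const (c ^ 2) x).congr_of_eventuallyEq (hc.mono fun y hy => by simp [hy])
  have h3 := h1.unique h2
  obtain ⟨v, hv⟩ : ∃ v, (A : E →ₗ[ℝ] E) v = r x :=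
    (LinearMap.isUnit_iff_range_eq_top _).1
      ((LinearMap.isUnit_iff_isUnit_det _).2 (isUnit_iff_ne_zero.2 hdet)) |> LinearMap.range_eq_top.1
      |> fun h => h (r x)
  have h4 := DFunLike.congr_fun h3 v
  simp only [ContinuousLinearMap.coe_coe] at hv
  simp [hv] at h4
  exact hx h4

/-- No-retraction theorem for Lipschitz maps. -/
theorem LipschitzWith.exists_norm_ne_of_eqOn_compl_ball {r : E → E} {K : NNReal}
    (hr : LipschitzWith K r) {R : ℝ} (hR : 0 < R) (hid : ∀ x, R ≤ ‖x‖ → r x = x) :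
    ∃ x ∈ ball (0 : E) R, ‖r x‖ ≠ R := by
  by_contra! hcon
  borelize E
  let μ : Measure E := Measure.addHaar
  have hg : LipschitzWith (K + 1) (fun x => r x - x) := hr.sub LipschitzWith.id
  have hint := integral_det_one_add_fderiv μ hg (R := R) fun x hx => by simp [hid x hx]
  have hzero : ∀ᵐ x ∂μ.restrict (ball 0 R), (1 + fderiv ℝ (fun x => r x - x) x).det = 0 := by
    filter_upwards [ae_restrict_mem measurableSet_ball,
      ae_restrict_of_ae (hr.ae_differentiableAt (μ := μ))] with x hx hd
    have hD : HasFDerivAt r (1 + fderiv ℝ (fun x => r x - x) x) x := by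
      have := (hd.hasFDerivAt.sub (hasFDerivAt_id x)).differentiableAt.hasFDerivAt.add
        (hasFDerivAt_id x)
      refine (this.congr_of_eventuallyEq (Eventually.of_forall fun y => by simp)).congr_fderiv ?_
      rw [add_comm]
      rfl
    refine det_eq_zero_of_norm_eventually_const hD
      (mem_of_superset (isOpen_ball.mem_nhds hx) hcon) ?_
    rw [← norm_ne_zero_iff, hcon x hx]
    exact hR.ne'
  rw [integral_congr_ae hzero, integral_zero] at hint
  have : 0 < μ.real (ball (0 : E) R) :=
    ENNReal.toReal_pos (measure_ball_pos μ _ hR).ne' measure_ball_lt_top.ne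
  exact this.ne hint

theorem LipschitzWith.exists_fixedPoint_of_norm_le_one {f : E → E} {K : NNReal}
    (hf : LipschitzWith K f) (hf1 : ∀ x, ‖f x‖ ≤ 1) : ∃ x, f x = x := by
  by_contra! hcon
  let φ : E → ℝ := fun x => max 0 (min 1 (2 - ‖x‖))
  have hφL : LipschitzWith 1 φ := by
    have h : LipschitzWith 1 (fun x : E => 2 - ‖x‖) := by
      simpa using (LipschitzWith.const (2 : ℝ)).sub (lipschitzWith_one_norm (E := E))
    exact (h.const_min 1).const_max 0
  have hφ0 : ∀ x, 0 ≤ φ x := fun x => le_max_left _ _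
  have hφ1 : ∀ x, φ x ≤ 1 := fun x => max_le zero_le_one (min_le_left _ _)
  have hφ2 : ∀ x, 2 ≤ ‖x‖ → φ x = 0 := fun x hx => by
    simp only [φ]
    exact max_eq_left ((min_le_right _ _).trans (by linarith))
  have hφ3 : ∀ x, ‖x‖ ≤ 1 → φ x = 1 := fun x hx => by
    simp only [φ]
    rw [min_eq_left (by linarith), max_eq_right zero_le_one]
  have hφ4 : ∀ x, ‖x‖ ≤ 2 → φ x ≤ 2 - ‖x‖ := fun x hx =>
    max_le (by linarith) (min_le_right _ _)
  -- `h` is `x - f x` on the unit ball, the identity beyond radius 2, and has no zero.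
  let h : E → E := fun x => x - φ x • f x
  have hhL : LipschitzWith (1 + (1 * K + 1 * 1)) h :=
    LipschitzWith.id.sub (hφL.smul_of_bounded hf (a := 1) (b := 1)
      (fun x => by simpa [abs_of_nonneg (hφ0 x)] using hφ1 x) (by simpa using hf1))
  have hsm : ∀ x, ‖φ x • f x‖ ≤ φ x := fun x => by
    rw [norm_smul, Real.norm_of_nonneg (hφ0 x)]
    exact mul_le_of_le_one_right (hφ0 x) (hf1 x)
  have hh0 : ∀ x, h x ≠ 0 := fun x hx => by
    have hx' : x = φ x • f x := sub_eq_zero.1 hx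
    rcases le_or_gt ‖x‖ 1 with h1 | h1
    · rw [hφ3 x h1, one_smul] at hx'
      exact hcon x hx'.symm
    · have := hsm x
      rw [← hx'] at this
      linarith [hφ1 x]
  have hh2 : ∀ x, 2 ≤ ‖x‖ → h x = x := fun x hx => by simp [h, hφ2 x hx]
  have hhle : ∀ x, ‖x‖ ≤ 2 → ‖h x‖ ≤ 2 := fun x hx =>
    (_root_.norm_sub_le _ _).trans (by linarith [hsm x, hφ4 x hx])
  obtain ⟨ε, hε, hε2, hhε⟩ : ∃ ε : ℝ, 0 < ε ∧ ε ≤ 2 ∧ ∀ x, ε ≤ ‖h x‖ := by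
    obtain ⟨z, -, hz⟩ := (isCompact_closedBall (0 : E) 2).exists_isMinOn
      ⟨0, by simp⟩ (hhL.continuous.norm.continuousOn)
    refine ⟨min 2 ‖h z‖, lt_min two_pos (norm_pos_iff.2 (hh0 z)), min_le_left _ _, fun x => ?_⟩
    rcases le_or_gt ‖x‖ 2 with hx | hx
    · exact (min_le_right _ _).trans (hz (by simpa using hx))
    · rw [hh2 x hx.le]
      exact (min_le_left _ _).trans hx.le
  -- Pushes the shell `ε ≤ ‖y‖ ≤ 2` radially onto the sphere of radius 2 and fixes everything
  -- outside, so `ψ ∘ h` is a forbidden retraction.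
  let ψ : E → E := fun y => (2 : ℝ) • ((max ε ‖y‖)⁻¹ • y) + (y - (2 : ℝ) • ((max 2 ‖y‖)⁻¹ • y))
  obtain ⟨L, hψL⟩ : ∃ L, LipschitzWith L ψ :=
    ⟨_, ((lipschitzWith_smul (2 : ℝ)).comp (lipschitzWith_max_norm_inv_smul hε)).add
      (LipschitzWith.id.sub ((lipschitzWith_smul (2 : ℝ)).comp
        (lipschitzWith_max_norm_inv_smul two_pos)))⟩
  have hψ1 : ∀ y, 2 ≤ ‖y‖ → ψ y = y := fun y hy => by
    simp only [ψ]
    rw [max_eq_right hy, max_eq_right (hε2.trans hy)]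
    abel
  have hψ2 : ∀ y, ε ≤ ‖y‖ → ‖y‖ ≤ 2 → ‖ψ y‖ = 2 := fun y hy hy2 => by
    have : ψ y = (2 : ℝ) • (‖y‖⁻¹ • y) := by
      simp only [ψ]
      rw [max_eq_right hy, max_eq_left hy2, smul_inv_smul₀ two_ne_zero, sub_self, add_zero]
    have hne : ‖y‖ ≠ 0 := (hε.trans_le hy).ne'
    rw [this, norm_smul, norm_smul, norm_inv, norm_norm, inv_mul_cancel₀ hne]
    norm_num
  obtain ⟨x, hx, hxne⟩ := (hψL.comp hhL).exists_norm_ne_of_eqOn_compl_ball two_pos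
    fun x hx => by
      simp only [Function.comp_apply]
      rw [hh2 x hx, hψ1 x hx]
  exact hxne (hψ2 _ (hhε x) (hhle x (mem_ball_zero_iff.1 hx).le))

/-- **Brouwer's fixed point theorem** for a continuous map of a Euclidean space into its unit
ball. -/
theorem Continuous.exists_fixedPoint_of_norm_le_one {f : E → E} (hf : Continuous f)
    (hf1 : ∀ x, ‖f x‖ ≤ 1) : ∃ x, f x = x := by
  have happrox : ∀ ε : ℝ, 0 < ε → ∃ x ∈ closedBall (0 : E) 1, ‖f x - x‖ ≤ ε := by
    intro ε' hε'
    set ε := ε' / 2 with hεdef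
    have hε : 0 < ε := by positivity
    let φ : E → ℝ := fun x => max 0 (min 1 (2 - ‖x‖))
    have hφ0 : ∀ x, 0 ≤ φ x := fun x => le_max_left _ _
    have hφ1 : ∀ x, φ x ≤ 1 := fun x => max_le zero_le_one (min_le_left _ _)
    have hφ3 : ∀ x, ‖x‖ ≤ 1 → φ x = 1 := fun x hx => by
      simp only [φ]
      rw [min_eq_left (by linarith), max_eq_right zero_le_one]
    have hF : Continuous (fun x => φ x • f x) := by fun_prop
    -- The cutoff gives `g` compact support, so being `C¹` makes it Lipschitz; dividing by `1 + ε`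
    -- then restores the bound 1.
    obtain ⟨g, hgd, hgf, hgs⟩ := hF.exists_contDiff_approx 1 (ε := fun _ => ε) continuous_const
      fun _ => hε
    have hgc : HasCompactSupport g := by
      refine HasCompactSupport.intro (isCompact_closedBall (0 : E) 2) fun x hx => ?_
      by_contra hne
      refine hgs hne ?_
      have : φ x = 0 := max_eq_left ((min_le_right _ _).trans (by
        simp only [mem_closedBall, dist_zero_right, not_le] at hx
        linarith))
      simp [this]
    obtain ⟨K, hK⟩ := ContDiff.lipschitzWith_of_hasCompactSupport hgc hgd (by simp)
    have hg1 : ∀ x, ‖g x‖ ≤ 1 + ε := fun x => by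
      have h1 := hgf x
      rw [dist_eq_norm] at h1
      have h2 : ‖φ x • f x‖ ≤ 1 := by
        rw [norm_smul, Real.norm_of_nonneg (hφ0 x)]
        exact mul_le_one₀ (hφ1 x) (norm_nonneg _) (hf1 x)
      have h3 := norm_add_le (g x - φ x • f x) (φ x • f x)
      rw [sub_add_cancel] at h3
      linarith
    have h1ε : 0 < 1 + ε := by positivity
    have hGle : ∀ x, ‖(1 + ε)⁻¹ • g x‖ ≤ 1 := fun x => by
      rw [norm_smul, norm_inv, Real.norm_of_nonneg h1ε.le, inv_mul_le_one₀ h1ε]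
      exact hg1 x
    obtain ⟨x, hx⟩ := ((lipschitzWith_smul ((1 + ε)⁻¹ : ℝ)).comp hK)
      |>.exists_fixedPoint_of_norm_le_one hGle
    simp only [Function.comp_apply] at hx
    have hx1 : ‖x‖ ≤ 1 := by
      rw [← hx]
      exact hGle x
    have hgx : g x = x + ε • x := by
      conv_rhs => rw [← one_smul ℝ x, smul_smul, ← add_smul, mul_one, ← hx]
      rw [smul_inv_smul₀ h1ε.ne']
    refine ⟨x, by simpa using hx1, ?_⟩
    have h1 := hgf x
    rw [dist_eq_norm, hφ3 x hx1, one_smul, hgx] at h1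
    calc ‖f x - x‖ = ‖ε • x - (x + ε • x - f x)‖ := by congr 1; abel
      _ ≤ ε * ‖x‖ + ‖x + ε • x - f x‖ := by
        refine (norm_sub_le _ _).trans_eq ?_
        rw [norm_smul, Real.norm_of_nonneg hε.le]
      _ ≤ ε * 1 + ε := by gcongr
      _ = ε' := by rw [hεdef]; ring
  obtain ⟨z, hz, hzmin⟩ := (isCompact_closedBall (0 : E) 1).exists_isMinOn ⟨0, by simp⟩
    ((hf.sub continuous_id).norm.continuousOn)
  refine ⟨z, ?_⟩
  by_contra hne
  have hpos : 0 < ‖f z - z‖ := norm_pos_iff.2 (sub_ne_zero.2 hne)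
  obtain ⟨x, hx, hxle⟩ := happrox (‖f z - z‖ / 2) (by positivity)
  have h2 : ‖f z - z‖ ≤ ‖f x - x‖ := hzmin hx
  linarith

end Brouwer

/-! ### Schauder's fixed point theorem. -/

section Schauder

open Filter Topology

variable {V : Type*} [NormedAddCommGroup V] [NormedSpace ℝ V]

/-- Schauder projection: replacing `Φ x` by a convex combination of net points within `ε` of it
yields a finite-dimensional problem for Brouwer. -/
theorem Convex.exists_dist_map_le_of_finite_cover {X : Set V} (hX : Convex ℝ X) {Φ : X → X}
    (hΦ : Continuous Φ) (x₀ : X) {t : Set V} (ht : t ⊆ X) (hfin : t.Finite) {ε : ℝ}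
    (hcov : ∀ x, ∃ y ∈ t, dist (Φ x : V) y < ε) : ∃ x : X, dist (Φ x : V) x ≤ ε := by
  classical
  have : Fintype t := hfin.fintype
  -- The extra slot, carried by `x₀`, keeps the total weight positive for every `w`, so `p` is
  -- defined on the whole Euclidean space. It vanishes at the fixed point, whose coordinates sum to
  -- 1.
  let W : EuclideanSpace ℝ t → Option t → ℝ := fun w o =>
    o.elim (max 0 (1 - ∑ i, max 0 (w i))) fun i => max 0 (w i)
  let z : Option t → V := fun o => o.elim (x₀ : V) fun i => (i : V)
  have hW0 : ∀ w o, 0 ≤ W w o := by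
    rintro w (_ | i)
    · exact le_max_left _ _
    · exact le_max_left _ _
  have hWsum : ∀ w, 0 < ∑ o, W w o := by
    intro w
    rw [Fintype.sum_option]
    simp only [W, Option.elim]
    have h1 : 0 ≤ ∑ i, max 0 (w i) := Finset.sum_nonneg fun i _ => le_max_left _ _
    have h2 := le_max_right 0 (1 - ∑ i, max 0 (w i))
    linarith
  have hz : ∀ o, z o ∈ X := by
    rintro (_ | i)
    · exact x₀.2
    · exact ht i.2
  let p : EuclideanSpace ℝ t → X := fun w => ⟨Finset.univ.centerMass (W w) z,
    hX.centerMass_mem (fun o _ => hW0 w o) (hWsum w) fun o _ => hz o⟩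
  have hWc : ∀ o, Continuous fun w => W w o := by
    rintro (_ | i)
    · simp only [W, Option.elim]
      fun_prop
    · simp only [W, Option.elim]
      fun_prop
  have hp : Continuous p := by
    refine Continuous.subtype_mk ?_ _
    simp only [Finset.centerMass]
    refine Continuous.smul (Continuous.inv₀ ?_ fun w => (hWsum w).ne') ?_
    · exact continuous_finsetSum _ fun o _ => hWc o
    · exact continuous_finsetSum _ fun o _ => (hWc o).smul continuous_const
  let a : t → V → ℝ := fun i y => max 0 (ε - dist y i)
  have ha0 : ∀ i y, 0 ≤ a i y := fun i y => le_max_left _ _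
  have hac : ∀ i, Continuous (a i) := fun i => by
    simp only [a]
    fun_prop
  have hA : ∀ x, 0 < ∑ i, a i (Φ x) := by
    intro x
    obtain ⟨y, hy, hd⟩ := hcov x
    refine Finset.sum_pos' (fun i _ => ha0 i _) ⟨⟨y, hy⟩, Finset.mem_univ _, ?_⟩
    exact lt_max_of_lt_right (sub_pos.2 hd)
  let c : EuclideanSpace ℝ t → t → ℝ := fun w i => a i (Φ (p w)) / ∑ j, a j (Φ (p w))
  have hc0 : ∀ w i, 0 ≤ c w i := fun w i => div_nonneg (ha0 _ _) (hA _).le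
  have hcsum : ∀ w, ∑ i, c w i = 1 := fun w => by
    simp only [c]
    rw [← Finset.sum_div, div_self (hA _).ne']
  have hcc : ∀ i, Continuous fun w => c w i := fun i =>
    ((hac i).comp (continuous_subtype_val.comp (hΦ.comp hp))).div
      (continuous_finsetSum _ fun j _ => (hac j).comp (continuous_subtype_val.comp (hΦ.comp hp)))
      fun w => (hA _).ne'
  obtain ⟨w, hw⟩ := Continuous.exists_fixedPoint_of_norm_le_one (E := EuclideanSpace ℝ t)
    (f := fun w => WithLp.toLp 2 (c w))
    ((PiLp.continuous_toLp 2 _).comp (continuous_pi hcc)) fun w => by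
      rw [EuclideanSpace.norm_eq, Real.sqrt_le_one]
      rw [← hcsum w]
      refine Finset.sum_le_sum fun i _ => ?_
      simp only [Real.norm_of_nonneg (hc0 w i)]
      have : c w i ≤ 1 := by
        rw [← hcsum w]
        exact Finset.single_le_sum (fun j _ => hc0 w j) (Finset.mem_univ i)
      nlinarith [hc0 w i]
  have hwi : ∀ i, w i = c w i := fun i => by
    conv_lhs => rw [← hw]
  have hpw : (p w : V) = ∑ i, c w i • (i : V) := by
    have h1 : ∀ i, max 0 (w i) = c w i := fun i => by rw [hwi, max_eq_right (hc0 w i)]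
    simp only [p, Finset.centerMass, Fintype.sum_option, W, Option.elim, z, h1, hcsum]
    simp
  refine ⟨p w, ?_⟩
  have hy : ((Φ (p w) : X) : V) = ∑ i, c w i • ((Φ (p w) : X) : V) := by
    rw [← Finset.sum_smul, hcsum, one_smul]
  rw [dist_eq_norm, hy, hpw, ← Finset.sum_sub_distrib]
  refine (norm_sum_le _ _).trans ?_
  calc _ ≤ ∑ i, c w i * ε := by
        refine Finset.sum_le_sum fun i _ => ?_
        rw [← smul_sub, norm_smul, Real.norm_of_nonneg (hc0 w i), ← dist_eq_norm]
        rcases le_or_gt (dist ((Φ (p w) : X) : V) i) ε with h | h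
        · exact mul_le_mul_of_nonneg_left h (hc0 w i)
        · have : c w i = 0 := by
            simp only [c, a]
            rw [max_eq_left (by linarith), zero_div]
          simp [this]
    _ = ε := by rw [← Finset.sum_mul, hcsum, one_mul]

/-- **Schauder's fixed point theorem**. -/
theorem Convex.exists_fixedPoint_of_isCompact_closure {X : Set V} (hX : Convex ℝ X)
    (hXc : IsClosed X) (hne : X.Nonempty) {Φ : X → X} (hΦ : Continuous Φ)
    (hcomp : IsCompact (closure (range fun x => (Φ x : V)))) : ∃ x, Φ x = x := by
  have hsub : closure (range fun x => (Φ x : V)) ⊆ X :=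
    closure_minimal (range_subset_iff.2 fun x => (Φ x).2) hXc
  obtain ⟨x₀, hx₀⟩ := hne
  have happrox : ∀ n : ℕ, ∃ x : X, dist (Φ x : V) x ≤ 1 / ((n : ℝ) + 1) := fun n => by
    obtain ⟨t, ht, hfin, hcov⟩ := finite_cover_balls_of_compact hcomp
      (show 0 < 1 / ((n : ℝ) + 1) by positivity)
    refine hX.exists_dist_map_le_of_finite_cover hΦ ⟨x₀, hx₀⟩ (ht.trans hsub) hfin fun x => ?_
    simpa using hcov (subset_closure (mem_range_self x))
  choose u hu using happrox
  obtain ⟨y, hy, φ, hφ, hlim⟩ := hcomp.tendsto_subseq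
    (fun n => subset_closure (mem_range_self (u n)))
  have hu0 : Tendsto (fun n => dist (Φ (u (φ n)) : V) (u (φ n))) atTop (𝓝 0) :=
    squeeze_zero (fun _ => dist_nonneg) (fun n => hu _)
      (tendsto_one_div_add_atTop_nhds_zero_nat.comp hφ.tendsto_atTop)
  have hlim' : Tendsto (fun n => (u (φ n) : V)) atTop (𝓝 y) :=
    (tendsto_iff_of_dist hu0).1 hlim
  have hlimX : Tendsto (fun n => u (φ n)) atTop (𝓝 ⟨y, hsub hy⟩) :=
    tendsto_subtype_rng.2 hlim'
  have h1 := (hΦ.tendsto ⟨y, hsub hy⟩).comp hlimX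
  refine ⟨⟨y, hsub hy⟩, Subtype.ext ?_⟩
  exact tendsto_nhds_unique ((continuous_subtype_val.tendsto _).comp h1) hlim

end Schauder

/-! ### Arzelà–Ascoli from a dense set of points. -/

section ArzelaAscoli

open Filter Topology

theorem isCompact_closure_of_lipschitzWith_of_dense {X Y : Type*} [PseudoMetricSpace X]
    [CompactSpace X] [MetricSpace Y] [CompleteSpace Y] {A : Set C(X, Y)} {L : NNReal}
    (hA : ∀ f ∈ A, LipschitzWith L f) {Q : Set X} (hQ : Dense Q)
    (hc : ∀ q ∈ Q, IsCompact (closure ((fun f : C(X, Y) => f q) '' A))) :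
    IsCompact (closure A) := by
  have htb : TotallyBounded {y : Y | ∃ f ∈ A, ∃ x, f x = y} := by
    refine Metric.totallyBounded_iff.2 fun ε hε => ?_
    -- Finitely many points of `Q` suffice: values move by at most `ε / 2` on each ball. The `+ 1`
    -- covers `L = 0`.
    obtain ⟨F, hFQ, hF, hcov⟩ := isCompact_univ.elim_finite_subcover_image (b := Q)
      (c := fun q => Metric.ball q (ε / 2 / (L + 1))) (fun q _ => Metric.isOpen_ball)
      fun x _ => by
        obtain ⟨q, hq, hxq⟩ := hQ.exists_dist_lt x (show 0 < ε / 2 / ((L : ℝ) + 1) by positivity)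
        exact mem_iUnion₂.2 ⟨q, hq, hxq⟩
    have hC : IsCompact (⋃ q ∈ F, closure ((fun f : C(X, Y) => f q) '' A)) :=
      hF.isCompact_biUnion fun q hq => hc q (hFQ hq)
    obtain ⟨t, -, ht, htc⟩ := finite_cover_balls_of_compact hC (half_pos hε)
    refine ⟨t, ht, ?_⟩
    rintro _ ⟨f, hf, x, rfl⟩
    obtain ⟨q, hq, hxq⟩ := mem_iUnion₂.1 (hcov (mem_univ x))
    obtain ⟨y, hy, hfy⟩ := mem_iUnion₂.1
      (htc (mem_iUnion₂.2 ⟨q, hq, subset_closure (mem_image_of_mem _ hf)⟩))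
    refine mem_iUnion₂.2 ⟨y, hy, ?_⟩
    have h1 : dist (f x) (f q) ≤ ε / 2 := by
      refine ((hA f hf).dist_le_mul x q).trans ?_
      have h2 : dist x q ≤ ε / 2 / (L + 1) := (Metric.mem_ball.1 hxq).le
      have h3 : (L : ℝ) * (ε / 2 / (L + 1)) ≤ ε / 2 := by
        rw [mul_div_assoc', div_le_iff₀ (by positivity)]
        nlinarith
      exact (mul_le_mul_of_nonneg_left h2 L.2).trans h3
    exact (dist_triangle _ _ _).trans_lt (by linarith [Metric.mem_ball.1 hfy])
  let e := ContinuousMap.isometryEquivBoundedOfCompact X Y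
  have hcomp : IsCompact (closure (e '' A)) := by
    refine BoundedContinuousFunction.arzela_ascoli _
      (htb.closure.isCompact_of_isClosed isClosed_closure) _ ?_ ?_
    · rintro _ x ⟨f, hf, rfl⟩
      exact subset_closure ⟨f, hf, x, rfl⟩
    · refine (LipschitzWith.uniformEquicontinuous _ L ?_).equicontinuous
      rintro ⟨_, f, hf, rfl⟩
      exact hA f hf
  have : closure (e '' A) = e '' closure A := (e.toHomeomorph.image_closure A).symm
  rw [this] at hcomp
  exact e.toHomeomorph.isCompact_image.1 hcomp

end ArzelaAscoli

/-! ### Calculus for absolutely continuous vector-valued curves. -/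

section AbsolutelyContinuous

open Filter Topology

variable {E F : Type*} [NormedAddCommGroup E] [NormedSpace ℝ E] [NormedAddCommGroup F]
  [NormedSpace ℝ F]

theorem AbsolutelyContinuousOnInterval.clm_comp {f : ℝ → E} {a b : ℝ}
    (hf : AbsolutelyContinuousOnInterval f a b) (g : E →L[ℝ] F) :
    AbsolutelyContinuousOnInterval (fun x => g (f x)) a b := by
  refine squeeze_zero (fun t => ?_) (fun t => ?_)
    (by simpa using Tendsto.const_mul ‖g‖ hf)
  · exact Finset.sum_nonneg fun i _ => dist_nonneg
  · rw [Finset.mul_sum]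
    exact Finset.sum_le_sum fun i _ => g.lipschitz.dist_le_mul _ _

/-- A norming functional reduces this to the scalar fundamental theorem of calculus, so no
vector-valued integral is needed. -/
theorem AbsolutelyContinuousOnInterval.norm_sub_le {f : ℝ → E} {a b C : ℝ} (hab : a ≤ b)
    (hf : AbsolutelyContinuousOnInterval f a b) {S : Set ℝ} (hS : volume S = 0)
    (hd : ∀ s ∈ Icc a b \ S, ∃ f', HasDerivWithinAt f f' (Icc a b) s ∧ ‖f'‖ ≤ C) :
    ‖f b - f a‖ ≤ C * (b - a) := by
  obtain ⟨g, hg1, hg⟩ := exists_dual_vector'' ℝ (f b - f a)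
  have h1 := (hf.clm_comp g).integral_deriv_eq_sub
  rw [← map_sub, hg] at h1
  have h2 : ‖∫ x in a..b, deriv (fun x => g (f x)) x‖ ≤ C * |b - a| := by
    refine intervalIntegral.norm_integral_le_of_norm_le_const_ae ?_
    filter_upwards [measure_eq_zero_iff_ae_notMem.1 hS,
      measure_eq_zero_iff_ae_notMem.1 (measure_singleton (μ := volume) b)] with x hxS hxb hx
    rw [uIoc_of_le hab] at hx
    obtain ⟨f', hf', hC⟩ := hd x ⟨Ioc_subset_Icc_self hx, hxS⟩
    have hx' : Icc a b ∈ 𝓝 x := Icc_mem_nhds hx.1 (lt_of_le_of_ne hx.2 hxb)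
    have hgd : HasDerivAt (fun x => g (f x)) (g f') x :=
      g.hasFDerivAt.comp_hasDerivAt x (hf'.hasDerivAt hx')
    rw [hgd.deriv]
    refine (g.le_opNorm f').trans ?_
    exact (mul_le_of_le_one_left (norm_nonneg _) hg1).trans hC
  rw [h1, abs_of_nonneg (sub_nonneg.2 hab)] at h2
  simpa using h2

/-- Product rule without operator-norm differentiability of `P`: the uniform bound on `P σ` absorbs
the error of the difference quotient of `v`. -/
theorem HasDerivWithinAt.clm_apply_of_strongly_continuous {P : ℝ → E →L[ℝ] F} {v : ℝ → E}
    {v' : E} {w : F} {I : Set ℝ} {s c : ℝ} (hP : ∀ σ ∈ I, ‖P σ‖ ≤ c)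
    (hPc : ContinuousWithinAt (fun σ => P σ v') I s)
    (hPd : HasDerivWithinAt (fun σ => P σ (v s)) w I s) (hv : HasDerivWithinAt v v' I s) :
    HasDerivWithinAt (fun σ => P σ (v σ)) (w + P s v') I s := by
  have hsecond : HasDerivWithinAt (fun σ => P σ (v σ - v s)) (P s v') I s := by
    rw [hasDerivWithinAt_iff_tendsto_slope] at hv ⊢
    have h1 : Tendsto (fun σ => P σ (slope v s σ - v')) (𝓝[I \ {s}] s) (𝓝 0) := by
      have h2 := (tendsto_sub_nhds_zero_iff.2 hv).norm.const_mul c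
      rw [norm_zero, mul_zero] at h2
      refine squeeze_zero_norm' ?_ h2
      filter_upwards [self_mem_nhdsWithin] with σ hσ
      exact (P σ).le_of_opNorm_le (hP σ hσ.1) _
    have h3 := h1.add (hPc.mono_left (nhdsWithin_mono s sdiff_subset))
    rw [zero_add] at h3
    refine h3.congr fun σ => ?_
    rw [← map_add, sub_add_cancel, slope_def_module, slope_def_module]
    simp
  exact (hPd.add hsecond).congr (fun σ _ => by simp) (by simp)

end AbsolutelyContinuous

/-! ### Propagator estimates and the path space. -/

namespace PathKinetic

variable {B D : Type*} [NormedAddCommGroup B] [NormedSpace ℝ B]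
  [NormedAddCommGroup D] [NormedSpace ℝ D]
  {ι : D →L[ℝ] B} {T : ℝ} {A A' : ℝ → D →L[ℝ] B} {U U' : ℝ → ℝ → B →L[ℝ] B} {S S' : Set ℝ}
  {c₁ c₂ c₃ : ℝ}

theorem Generates.norm_right_sub_le (hU : Generates ι T A U S)
    (hA : ∀ t ∈ Icc 0 T, ‖A t‖ ≤ c₁) (hB : ∀ t s, 0 ≤ t → t ≤ s → s ≤ T → ‖U t s‖ ≤ c₃)
    {t s r : ℝ} (ht : 0 ≤ t) (hts : t ≤ s) (hsr : s ≤ r) (hr : r ≤ T) (f : D) :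
    ‖U t r (ι f) - U t s (ι f)‖ ≤ c₃ * c₁ * ‖f‖ * (r - s) := by
  have hsub : Icc s r ⊆ Icc t T := Icc_subset_Icc hts hr
  have htT : t ∈ Icc 0 T := ⟨ht, hts.trans (hsr.trans hr)⟩
  refine ((hU.absCont_right t htT f).mono ?_).norm_sub_le hsr hU.null fun σ hσ =>
    ⟨_, (hU.deriv_right t htT f σ ⟨hsub hσ.1, hσ.2⟩).mono hsub, ?_⟩
  · rwa [uIcc_of_le hsr, uIcc_of_le htT.2]
  · have hσ' := hsub hσ.1
    have h0 : 0 ≤ σ := ht.trans hσ'.1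
    calc ‖U t σ (A σ f)‖ ≤ c₃ * ‖A σ f‖ := (U t σ).le_of_opNorm_le (hB t σ ht hσ'.1 hσ'.2) _
      _ ≤ c₃ * (c₁ * ‖f‖) := by
        have : 0 ≤ c₃ := (norm_nonneg _).trans (hB t σ ht hσ'.1 hσ'.2)
        gcongr
        exact (A σ).le_of_opNorm_le (hA σ ⟨h0, hσ'.2⟩) _
      _ = c₃ * c₁ * ‖f‖ := by ring

theorem Generates.norm_left_sub_le (hU : Generates ι T A U S)
    (hA : ∀ t ∈ Icc 0 T, ‖A t‖ ≤ c₁)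
    (hD : ∀ t s, 0 ≤ t → t ≤ s → s ≤ T → ∀ f g : D, ι g = U t s (ι f) → ‖g‖ ≤ c₂ * ‖f‖)
    {t s r : ℝ} (ht : 0 ≤ t) (hts : t ≤ s) (hsr : s ≤ r) (hr : r ≤ T) (f : D) :
    ‖U s r (ι f) - U t r (ι f)‖ ≤ c₁ * c₂ * ‖f‖ * (s - t) := by
  have hsub : Icc t s ⊆ Icc 0 r := Icc_subset_Icc ht hsr
  have hrT : r ∈ Icc 0 T := ⟨ht.trans (hts.trans hsr), hr⟩
  refine ((hU.absCont_left r hrT f).mono ?_).norm_sub_le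
    (f := fun s => U s r (ι f)) hts hU.null fun σ hσ => ?_
  · rwa [uIcc_of_le hts, uIcc_of_le hrT.1]
  · have hσ' := hsub hσ.1
    obtain ⟨g, hg⟩ := hU.invariant σ r hσ'.1 hσ'.2 hr f
    refine ⟨_, (hU.deriv_left r hrT f σ ⟨hσ', hσ.2⟩ g hg).mono hsub, ?_⟩
    have hAσ := hA σ ⟨hσ'.1, hσ'.2.trans hr⟩
    have : 0 ≤ c₁ := (norm_nonneg _).trans hAσ
    calc ‖-(A σ g)‖ ≤ c₁ * ‖g‖ := by
          rw [norm_neg]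
          exact (A σ).le_of_opNorm_le hAσ _
      _ ≤ c₁ * (c₂ * ‖f‖) := by
        gcongr
        exact hD σ r hσ'.1 hσ'.2 hr f g hg
      _ = c₁ * c₂ * ‖f‖ := by ring

/-- Duhamel: `s ↦ U^{0,s} U'^{s,t} f` joins `U'^{0,t} f` to `U^{0,t} f`, with derivative `U^{0,s}
(A_s - A'_s) U'^{s,t} f` outside both null sets. -/
theorem Generates.norm_sub_le (hP : IsBackwardPropagator T U) (hP' : IsBackwardPropagator T U')
    (hU : Generates ι T A U S) (hU' : Generates ι T A' U' S')
    (hA : ∀ t ∈ Icc 0 T, ‖A t‖ ≤ c₁) (hA' : ∀ t ∈ Icc 0 T, ‖A' t‖ ≤ c₁)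
    (hB : ∀ t s, 0 ≤ t → t ≤ s → s ≤ T → ‖U t s‖ ≤ c₃)
    (hD : ∀ t s, 0 ≤ t → t ≤ s → s ≤ T → ∀ f g : D, ι g = U' t s (ι f) → ‖g‖ ≤ c₂ * ‖f‖)
    {δ : ℝ} (hδ : ∀ t ∈ Icc 0 T, ‖A t - A' t‖ ≤ δ) {t : ℝ} (ht : t ∈ Icc 0 T) (f : D) :
    ‖U 0 t (ι f) - U' 0 t (ι f)‖ ≤ c₃ * (δ * (c₂ * ‖f‖)) * t := by
  have h0T : (0 : ℝ) ∈ Icc 0 T := ⟨le_rfl, ht.1.trans ht.2⟩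
  have hc₁ : 0 ≤ c₁ := (norm_nonneg _).trans (hA 0 h0T)
  have hδ0 : 0 ≤ δ := (norm_nonneg _).trans (hδ 0 h0T)
  have hc₃ : 0 ≤ c₃ := (norm_nonneg _).trans (hB 0 0 le_rfl le_rfl h0T.2)
  have hsubT : Icc 0 t ⊆ Icc 0 T := Icc_subset_Icc_right ht.2
  let g : ℝ → B := fun s => U 0 s (U' s t (ι f))
  have hg0 : g 0 = U' 0 t (ι f) := by simp [g, hP.refl 0 h0T]
  have hgt : g t = U 0 t (ι f) := by simp [g, hP'.refl t ht]
  -- Absolute continuity of the product comes from a Lipschitz bound: the increment splits so that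
  -- `U` acts differentiably only on `v ∈ D`, where `ι v = U'^{s,t} f`.
  have hlip : ∀ s ∈ Icc 0 t, ∀ r ∈ Icc 0 t, s ≤ r →
      ‖g r - g s‖ ≤ (c₃ * (c₁ * c₂ * ‖f‖) + c₃ * c₁ * (c₂ * ‖f‖)) * (r - s) := by
    intro s hs r hr hsr
    obtain ⟨v, hv⟩ := hU'.invariant s t hs.1 hs.2 ht.2 f
    have heq : g r - g s = U 0 r (U' r t (ι f) - U' s t (ι f)) + (U 0 r (ι v) - U 0 s (ι v)) := by
      simp only [g, map_sub, hv]
      abel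
    rw [heq]
    refine (norm_add_le _ _).trans ?_
    have h1 := hU.norm_right_sub_le hA hB le_rfl hs.1 hsr (hsubT hr).2 v
    have h2 := hU'.norm_left_sub_le hA' hD hs.1 hsr hr.2 ht.2 f
    have h3 := (U 0 r).le_of_opNorm_le (hB 0 r le_rfl hr.1 (hsubT hr).2)
      (U' r t (ι f) - U' s t (ι f))
    have h4 := hD s t hs.1 hs.2 ht.2 f v hv
    have hrs : 0 ≤ r - s := sub_nonneg.2 hsr
    calc _ ≤ c₃ * (c₁ * c₂ * ‖f‖ * (r - s)) + c₃ * c₁ * (c₂ * ‖f‖) * (r - s) := by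
          refine add_le_add (h3.trans (by gcongr)) (h1.trans (by gcongr))
      _ = _ := by ring
  have hac : AbsolutelyContinuousOnInterval g 0 t := by
    refine LipschitzOnWith.absolutelyContinuousOnInterval
      (K := Real.toNNReal (c₃ * (c₁ * c₂ * ‖f‖) + c₃ * c₁ * (c₂ * ‖f‖))) ?_
    rw [uIcc_of_le ht.1]
    have hle : ∀ s ∈ Icc 0 t, ∀ r ∈ Icc 0 t, s ≤ r → dist (g s) (g r) ≤
        (Real.toNNReal (c₃ * (c₁ * c₂ * ‖f‖) + c₃ * c₁ * (c₂ * ‖f‖)) : ℝ) * dist s r := by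
      intro s hs r hr hsr
      rw [dist_comm, dist_comm s, dist_eq_norm, Real.dist_eq, abs_of_nonneg (sub_nonneg.2 hsr)]
      refine (hlip s hs r hr hsr).trans ?_
      have := sub_nonneg.2 hsr
      gcongr
      exact Real.le_coe_toNNReal _
    refine LipschitzOnWith.of_dist_le_mul fun s hs r hr => ?_
    rcases le_total s r with h | h
    · exact hle s hs r hr h
    · rw [dist_comm, dist_comm s]
      exact hle r hr s hs h
  have key := hac.norm_sub_le (C := c₃ * (δ * (c₂ * ‖f‖))) ht.1
    (measure_union_null hU.null hU'.null) fun s hs => by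
      have hsT := hsubT hs.1
      obtain ⟨v, hv⟩ := hU'.invariant s t hs.1.1 hs.1.2 ht.2 f
      have hd := hU'.deriv_left t ht f s ⟨hs.1, fun h => hs.2 (Or.inr h)⟩ v hv
      have hr := (hU.deriv_right 0 h0T v s ⟨hsT, fun h => hs.2 (Or.inl h)⟩).mono hsubT
      have hcont : ContinuousWithinAt (fun σ => U 0 σ (-(A' s v))) (Icc 0 t) s := by
        refine (hP.strongly_continuous (-(A' s v)) (0, s) ⟨le_rfl, hsT.1, hsT.2⟩).comp
          (f := fun σ : ℝ => ((0 : ℝ), σ)) (by fun_prop) ?_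
        exact fun σ hσ => ⟨le_rfl, hσ.1, (hsubT hσ).2⟩
      rw [hv] at hr
      refine ⟨_, HasDerivWithinAt.clm_apply_of_strongly_continuous
        (fun σ hσ => hB 0 σ le_rfl hσ.1 (hsubT hσ).2) hcont hr hd, ?_⟩
      rw [← map_add, ← sub_eq_add_neg, ← sub_apply]
      refine ((U 0 s).le_of_opNorm_le (hB 0 s le_rfl hsT.1 hsT.2) _).trans ?_
      gcongr
      refine ((A s - A' s).le_of_opNorm_le (hδ s hsT) _).trans ?_
      gcongr
      exact hD s t hs.1.1 hs.1.2 ht.2 f v hv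
  rwa [hg0, hgt, sub_zero] at key

theorem isClosed_pathSpace {M : Set (StrongDual ℝ B)} {μ : StrongDual ℝ B}
    (hM : IsClosed (toDualD ι '' M)) : IsClosed (PathSpace ι M T μ) := by
  have : PathSpace ι M T μ = (⋂ t, {ξ | ξ t ∈ toDualD ι '' M}) ∩
      ⋂ h : (0 : ℝ) ∈ Icc (0 : ℝ) T, {ξ | ξ ⟨0, h⟩ = toDualD ι μ} := by
    ext ξ
    simp [PathSpace]
  rw [this]
  refine (isClosed_iInter fun t => hM.preimage (continuous_eval_const t)).inter
    (isClosed_iInter fun h => isClosed_eq (continuous_eval_const _) continuous_const)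

theorem convex_pathSpace {M : Set (StrongDual ℝ B)} {μ : StrongDual ℝ B}
    (hM : Convex ℝ M) : Convex ℝ (PathSpace ι M T μ) := by
  intro ξ hξ η hη a b ha hb hab
  refine ⟨fun t => ?_, fun h => ?_⟩
  · obtain ⟨ν, hν, hνξ⟩ := hξ.1 t
    obtain ⟨ρ, hρ, hρη⟩ := hη.1 t
    refine ⟨a • ν + b • ρ, hM hν hρ ha hb hab, ?_⟩
    rw [ContinuousMap.add_apply, ContinuousMap.smul_apply, ContinuousMap.smul_apply, ← hνξ, ← hρη]
    rfl
  · rw [ContinuousMap.add_apply, ContinuousMap.smul_apply, ContinuousMap.smul_apply, hξ.2 h,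
      hη.2 h, ← add_smul, hab, one_smul]

/-- The `D*` norm tests only against `D`, which is where the propagator estimates hold. -/
theorem dist_toDualD_comp_le {μ : StrongDual ℝ B} {P P' : B →L[ℝ] B} {c : ℝ} (hc : 0 ≤ c)
    (h : ∀ f, ‖P (ι f) - P' (ι f)‖ ≤ c * ‖f‖) :
    dist (toDualD ι (μ.comp P)) (toDualD ι (μ.comp P')) ≤ ‖μ‖ * c := by
  rw [dist_eq_norm]
  refine ContinuousLinearMap.opNorm_le_bound _ (by positivity) fun f => ?_
  have heq : (toDualD ι (μ.comp P) - toDualD ι (μ.comp P')) f = μ (P (ι f) - P' (ι f)) := by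
    simp [toDualD]
  rw [heq, mul_assoc]
  refine (μ.le_opNorm _).trans ?_
  gcongr
  exact h f

end PathKinetic

/-! ### Existence by a fixed point in the path space. -/

theorem theorem4 {B D : Type*} [NormedAddCommGroup B] [NormedSpace ℝ B] [CompleteSpace B]
    [NormedAddCommGroup D] [NormedSpace ℝ D] [CompleteSpace D]
    -- `D` is a dense subspace of `B`, with a stronger norm
    (ι : D →L[ℝ] B) (hι_inj : Function.Injective ι) (hι_dense : DenseRange ι)
    (hι_norm : ∀ f : D, ‖ι f‖ ≤ ‖f‖)
    (T : ℝ) (hT : 0 < T)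
    -- the set `M`: bounded, convex, and closed in both `B*` and `D*`
    (M : Set (StrongDual ℝ B)) (K : ℝ) (hM_bdd : ∀ ν ∈ M, ‖ν‖ ≤ K) (hM_convex : Convex ℝ M)
    (hM_closed : IsClosed M) (hM_closedD : IsClosed (PathKinetic.toDualD ι '' M))
    (μ : StrongDual ℝ B) (hμ : μ ∈ M)
    (c₁ c₂ c₃ : ℝ) (hc₁ : 0 < c₁) (hc₂ : 0 < c₂) (hc₃ : 0 < c₃)
    -- (i) the operators `A[t, ξ]`
    (A : ℝ → PathKinetic.PathSpace ι M T μ → D →L[ℝ] B)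
    (hA_lip : ∀ ξ η : PathKinetic.PathSpace ι M T μ, ∀ t ∈ Set.Icc 0 T,
      ‖A t ξ - A t η‖ ≤ c₁ * ‖ξ.1 - η.1‖)
    (hA_bdd : ∀ ξ : PathKinetic.PathSpace ι M T μ, ∀ t ∈ Set.Icc 0 T, ‖A t ξ‖ ≤ c₁)
    -- (ii) the propagators `U[ξ]`
    (U : PathKinetic.PathSpace ι M T μ → ℝ → ℝ → B →L[ℝ] B)
    (S : PathKinetic.PathSpace ι M T μ → Set ℝ)
    (hU_prop : ∀ ξ, PathKinetic.IsBackwardPropagator T (U ξ))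
    (hU_gen : ∀ ξ, PathKinetic.Generates ι T (fun t => A t ξ) (U ξ) (S ξ))
    (hU_D : ∀ ξ, ∀ t s, 0 ≤ t → t ≤ s → s ≤ T →
      ∀ f g : D, ι g = U ξ t s (ι f) → ‖g‖ ≤ c₂ * ‖f‖)
    (hU_B : ∀ ξ, ∀ t s, 0 ≤ t → t ≤ s → s ≤ T → ‖U ξ t s‖ ≤ c₃)
    (hU_M : ∀ ξ, ∀ t s, 0 ≤ t → t ≤ s → s ≤ T →
      ∀ ν ∈ M, PathKinetic.dualPropagator (U ξ) s t ν ∈ M)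
    -- compactness: `Q` is dense in `[0,T]`
    (Q : Set ℝ) (hQ_sub : Q ⊆ Set.Icc 0 T) (hQ_dense : Set.Icc 0 T ⊆ closure Q)
    (hQ_compact : ∀ t ∈ Q, IsCompact (closure (PathKinetic.toDualD ι ''
      (Set.range fun ξ => PathKinetic.dualPropagator (U ξ) t 0 μ)))) :
    ∃ (ξ : PathKinetic.PathSpace ι M T μ) (ν : ℝ → StrongDual ℝ B),
      PathKinetic.IsSolution ι M T μ A (S ξ) ξ ν := by
  have h0T : (0 : ℝ) ∈ Icc 0 T := ⟨le_rfl, hT.le⟩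
  let path : PathKinetic.PathSpace ι M T μ → Icc (0 : ℝ) T → StrongDual ℝ D :=
    fun ξ t => PathKinetic.toDualD ι (PathKinetic.dualPropagator (U ξ) t 0 μ)
  have hL0 : 0 ≤ ‖μ‖ * (c₃ * c₁) := by positivity
  have hlip : ∀ ξ, LipschitzWith (Real.toNNReal (‖μ‖ * (c₃ * c₁))) (path ξ) := by
    intro ξ
    have hle : ∀ s t : Icc (0 : ℝ) T, s ≤ t →
        dist (path ξ t) (path ξ s) ≤ ‖μ‖ * (c₃ * c₁) * dist t s := by
      intro s t hst
      have hts : (0 : ℝ) ≤ t - s := sub_nonneg.2 (Subtype.coe_le_coe.2 hst)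
      have hd : dist t s = (t : ℝ) - s := by
        rw [Subtype.dist_eq, Real.dist_eq, abs_of_nonneg hts]
      rw [hd, mul_assoc]
      refine PathKinetic.dist_toDualD_comp_le (by positivity) fun f => ?_
      refine ((hU_gen ξ).norm_right_sub_le (hA_bdd ξ) (hU_B ξ) le_rfl s.2.1 hst t.2.2 f).trans_eq ?_
      ring
    refine LipschitzWith.of_dist_le_mul fun s t => ?_
    rw [Real.coe_toNNReal _ hL0]
    rcases le_total s t with h | h
    · rw [dist_comm, dist_comm s]
      exact hle s t h
    · exact hle t s h
  let Φ : PathKinetic.PathSpace ι M T μ → PathKinetic.PathSpace ι M T μ := fun ξ =>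
    ⟨⟨path ξ, (hlip ξ).continuous⟩,
    fun t => ⟨_, hU_M ξ 0 t le_rfl t.2.1 t.2.2 μ hμ, rfl⟩, fun h => by
      simp [path, PathKinetic.dualPropagator, (hU_prop ξ).refl 0 h0T]⟩
  have hΦ : Continuous Φ := by
    have hC0 : 0 ≤ ‖μ‖ * (c₃ * c₁ * c₂ * T) := by positivity
    suffices h : LipschitzWith (Real.toNNReal (‖μ‖ * (c₃ * c₁ * c₂ * T))) Φ from h.continuous
    refine LipschitzWith.of_dist_le_mul (α := PathKinetic.PathSpace ι M T μ)
      (β := PathKinetic.PathSpace ι M T μ) fun ξ η => ?_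
    rw [Real.coe_toNNReal _ hC0, Subtype.dist_eq,
      ContinuousMap.dist_le (mul_nonneg hC0 dist_nonneg)]
    intro t
    rw [mul_assoc]
    have hd : dist ξ η = ‖ξ.1 - η.1‖ := dist_eq_norm ξ.1 η.1
    refine PathKinetic.dist_toDualD_comp_le (c := c₃ * c₁ * c₂ * T * dist ξ η) (by positivity)
      fun f => ?_
    refine ((hU_gen ξ).norm_sub_le (hU_prop ξ) (hU_prop η) (hU_gen η) (hA_bdd ξ) (hA_bdd η)
      (hU_B ξ) (hU_D η) (hA_lip ξ η) t.2 f).trans ?_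
    rw [hd]
    calc c₃ * (c₁ * ‖ξ.1 - η.1‖ * (c₂ * ‖f‖)) * t
        ≤ c₃ * (c₁ * ‖ξ.1 - η.1‖ * (c₂ * ‖f‖)) * T := by
          gcongr
          exact t.2.2
      _ = c₃ * c₁ * c₂ * T * ‖ξ.1 - η.1‖ * ‖f‖ := by ring
  have hne : (PathKinetic.PathSpace ι M T μ).Nonempty :=
    ⟨ContinuousMap.const _ (PathKinetic.toDualD ι μ), fun _ => ⟨μ, hμ, rfl⟩, fun _ => rfl⟩
  have hQd : Dense {t : Icc (0 : ℝ) T | (t : ℝ) ∈ Q} := by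
    intro t
    rw [closure_subtype]
    have : ((↑) : Icc (0 : ℝ) T → ℝ) '' {t | (t : ℝ) ∈ Q} = Q := by
      ext q
      exact ⟨fun ⟨t, ht, h⟩ => h ▸ ht, fun hq => ⟨⟨q, hQ_sub hq⟩, hq, rfl⟩⟩
    rw [this]
    exact hQ_dense t.2
  have hcomp : IsCompact (closure (range fun ξ => (Φ ξ : C(Icc (0 : ℝ) T, StrongDual ℝ D)))) := by
    refine isCompact_closure_of_lipschitzWith_of_dense
      (L := Real.toNNReal (‖μ‖ * (c₃ * c₁))) ?_ hQd fun q hq => ?_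
    · rintro _ ⟨ξ, rfl⟩
      exact hlip ξ
    · have := hQ_compact q hq
      rw [← range_comp] at this ⊢
      exact this
  obtain ⟨ξ, hξ⟩ := (PathKinetic.convex_pathSpace hM_convex).exists_fixedPoint_of_isCompact_closure
    (PathKinetic.isClosed_pathSpace hM_closedD) hne hΦ hcomp
  refine ⟨ξ, fun t => PathKinetic.dualPropagator (U ξ) t 0 μ, ?_⟩
  refine ⟨fun t ht => hU_M ξ 0 t le_rfl ht.1 ht.2 μ hμ, fun t => ?_, ?_, fun f => ?_,
    fun f t ht => ?_⟩
  · exact DFunLike.congr_fun (congrArg Subtype.val hξ) t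
  · simp [PathKinetic.dualPropagator, (hU_prop ξ).refl 0 h0T]
  · exact ((hU_gen ξ).absCont_right 0 h0T f).clm_comp μ
  -- The derivative `μ (U^{0,t} A_t f)` is by definition the dual curve at `t` applied to `A_t f`.
  · exact (μ.hasFDerivAt.comp_hasDerivWithinAt t ((hU_gen ξ).deriv_right 0 h0T f t ht))
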